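/- Let $X\subseteq\mathbb{R}^m$ be a polyhedron, i.e. the solution set of finitely many weak linear inequalities. Let $I=\{1,\dots,n\}$ be a finite set of agents, and let each agent $i\in I$ have a utility function $u_i:X\to\mathbb{R}$ that is piecewise-linear concave, i.e. there are a finite nonempty index set $K_i$ and affine functions $u_{i,k}:\mathbb{R}^m\to\mathbb{R}$ ($k\in K_i$) with $u_i(x)=\min_{k\in K_i}u_{i,k}(x)$ for all $x\in X$. Put $\underline{u}_i=\inf_{x\in X}u_i(x)\in[-\infty,\infty]$ and $$U=\{(w_i)_{i\in I}\in\mathbb{R}^n \mid \exists x\in X\ \forall i\in I:\ \underline{u}_i\le w_i\le u_i(x)\}.$$ Then the downward closure $\mathrm{dc}(U)=\bigcup_{u\in U}(u-\mathbb{R}^n_+)$ is a polyhedron in $\mathbb{R}^n$. -/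

import Mathlib

/-- A (convex) polyhedron in `ℝ^d`: the solution set of a finite system of weak linear
inequalities `⟨a_j, x⟩ ≤ b_j`. -/
def IsPolyhedron {d : ℕ} (P : Set (Fin d → ℝ)) : Prop :=
  ∃ (r : ℕ) (a : Fin r → Fin d → ℝ) (b : Fin r → ℝ),
    P = {x | ∀ j, ∑ l, a j l * x l ≤ b j}

/-- A function `v : X → ℝ` is piecewise-linear concave if on `X` it is the minimum of a
finite nonempty family of affine functions. -/
def IsPLC {m : ℕ} {X : Set (Fin m → ℝ)} (v : X → ℝ) : Prop :=
  ∃ (N : ℕ) (f : Fin (N + 1) → ((Fin m → ℝ) →ᵃ[ℝ] ℝ)),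
    ∀ x : X, v x = Finset.univ.inf' Finset.univ_nonempty (fun k => f k (x : Fin m → ℝ))

/-- The utility possibility set
`U = {(u_i) | ∃ x ∈ X, ∀ i, u_i ∈ [inf_X u_i, u_i(x)]}` induced by utility functions
`u_i : X → ℝ`. The infimum is taken in the extended reals, so it is `-∞` (and imposes no
lower bound) when `u_i` is unbounded below on `X`. -/
noncomputable def utilityPossibilitySet {n m : ℕ} {X : Set (Fin m → ℝ)}
    (u : Fin n → X → ℝ) : Set (Fin n → ℝ) :=
  {w | ∃ x : X, ∀ i, (⨅ y : X, ((u i y : ℝ) : EReal)) ≤ ((w i : ℝ) : EReal) ∧ w i ≤ u i x}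

/-- The downward closure `dc(U) = ⋃_{u ∈ U} (u - ℝ^n_+)`. -/
def downwardClosure {n : ℕ} (U : Set (Fin n → ℝ)) : Set (Fin n → ℝ) :=
  ⋃ u ∈ U, {v | ∃ w : Fin n → ℝ, (∀ i, 0 ≤ w i) ∧ v = u - w}

/-!
When `X` is nonempty, any `v` lying below `u(x)` for some `x ∈ X` belongs to the downward closure,
because `u(x)` itself lies in the utility possibility set: the lower bounds `inf_X u_i` are
automatically satisfied there. Hence the downward closure is
`{v | ∃ x ∈ X, ∀ i, v_i ≤ u_i(x)}`, and the description remains valid (both sides are empty) when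
`X` is empty (`mem_downwardClosure_utilityPossibilitySet`).

Since `u_i` is a minimum of finitely many affine functions, the condition on `(v, x)` is a finite
system of weak linear inequalities, so the downward closure is a coordinate projection of a
polyhedron. Such a projection is a polyhedron by Fourier–Motzkin elimination
(`isPolyhedron_exists`), which removes the coordinates of `x` one at a time; the elimination of a
single real unknown is `exists_forall_add_mul_nonpos_iff`.
-/

/-- Elimination of one real unknown `t` from finitely many inequalities `h j + c j * t ≤ 0`:
the rows with `c j < 0` bound `t` from below, those with `0 < c j` bound it from above, and a
solution exists iff every lower bound is at most every upper bound and the rows free of `t`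
hold. -/
theorem exists_forall_add_mul_nonpos_iff {ι : Type*} [Finite ι] (h c : ι → ℝ) :
    (∃ t, ∀ j, h j + c j * t ≤ 0) ↔
      (∀ j, c j = 0 → h j ≤ 0) ∧
        ∀ p q, 0 < c p → c q < 0 → -c q * h p + c p * h q ≤ 0 := by
  constructor
  · rintro ⟨t, ht⟩
    refine ⟨fun j hj => by simpa [hj] using ht j, fun p q hp hq => ?_⟩
    have h₁ := mul_le_mul_of_nonneg_left (ht p) (neg_nonneg.2 hq.le)
    have h₂ := mul_le_mul_of_nonneg_left (ht q) hp.le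
    linarith
  · rintro ⟨hzero, hpair⟩
    obtain ⟨t, hlower, hupper⟩ :
        ∃ t, (∀ q, c q < 0 → -h q / c q ≤ t) ∧ ∀ p, 0 < c p → t ≤ -h p / c p := by
      rcases Set.eq_empty_or_nonempty {q | c q < 0} with hneg | hneg
      · obtain ⟨t, ht⟩ := ((Set.toFinite {p | 0 < c p}).image fun p => -h p / c p).bddBelow
        exact ⟨t, fun q hq => (Set.eq_empty_iff_forall_notMem.1 hneg q hq).elim,
          fun p hp => ht ⟨p, hp, rfl⟩⟩
      · obtain ⟨q, hq, hmax⟩ :=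
          Set.exists_max_image {q | c q < 0} (fun q => -h q / c q) (Set.toFinite _) hneg
        refine ⟨-h q / c q, hmax, fun p hp => ?_⟩
        rw [le_div_iff₀ hp, div_mul_eq_mul_div, div_le_iff_of_neg hq]
        linarith [hpair p q hp hq]
    refine ⟨t, fun j => ?_⟩
    rcases lt_trichotomy (c j) 0 with hj | hj | hj
    · linarith [(div_le_iff_of_neg hj).1 (hlower j hj)]
    · simpa [hj] using hzero j hj
    · linarith [(le_div_iff₀ hj).1 (hupper j hj)]

theorem isPolyhedron_setOf_forall_affine_nonpos {n : ℕ} {ι : Type*} [Finite ι]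
    (g : ι → (Fin n → ℝ) →ᵃ[ℝ] ℝ) : IsPolyhedron {v | ∀ j, g j v ≤ 0} := by
  obtain ⟨r, ⟨e⟩⟩ := Finite.exists_equiv_fin ι
  refine ⟨r, fun j l => (g (e.symm j)).linear (fun k => if l = k then 1 else 0),
    fun j => -g (e.symm j) 0, Set.ext fun v => ?_⟩
  have hg (j : ι) : g j v
      = ∑ l, (g j).linear (fun k => if l = k then 1 else 0) * v l + g j 0 := by
    rw [congrFun (g j).decomp v, Pi.add_apply, LinearMap.pi_apply_eq_sum_univ]
    simp [mul_comm]
  simp only [Set.mem_ofPred_eq, hg, le_neg_iff_add_nonpos_right]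
  exact (e.symm.forall_congr_right
    (q := fun j => ∑ l, (g j).linear (fun k => if l = k then 1 else 0) * v l + g j 0 ≤ 0)).symm

/-- Fourier–Motzkin elimination: the projection to the `v`-space of the solution set of a finite
system of weak linear inequalities in `(v, x)` is a polyhedron. The part of each row depending on
`v` is kept as an affine map, so that constant terms need no separate treatment. -/
theorem isPolyhedron_exists {n m : ℕ} {ι : Type*} [Finite ι]
    (f : ι → (Fin n → ℝ) →ᵃ[ℝ] ℝ) (c : ι → Fin m → ℝ) :
    IsPolyhedron {v | ∃ x : Fin m → ℝ, ∀ j, f j v + ∑ k, c j k * x k ≤ 0} := by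
  induction m generalizing ι with
  | zero => simpa using isPolyhedron_setOf_forall_affine_nonpos f
  | succ m ih =>
    -- The rows free of `x 0`, and the combinations of a pair of rows that cancel `x 0`.
    let pair := {pq : ι × ι // 0 < c pq.1 0 ∧ c pq.2 0 < 0}
    convert ih (ι := {j // c j 0 = 0} ⊕ pair)
      (Sum.elim (fun j => f j)
        fun pq => -c pq.1.2 0 • f pq.1.1 + c pq.1.1 0 • f pq.1.2)
      (Sum.elim (fun j k => c j k.succ)
        fun pq k => -c pq.1.2 0 * c pq.1.1 k.succ + c pq.1.1 0 * c pq.1.2 k.succ) using 1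
    ext v
    simp only [Set.mem_ofPred_eq]
    rw [Fin.exists_fin_succ_pi, exists_comm]
    refine exists_congr fun x => ?_
    have key := exists_forall_add_mul_nonpos_iff
      (fun j => f j v + ∑ k : Fin m, c j k.succ * x k) (fun j => c j 0)
    have hrow (t : ℝ) (j : ι) : f j v + ∑ k, c j k * (Fin.cons t x : Fin (m + 1) → ℝ) k
        = f j v + ∑ k : Fin m, c j k.succ * x k + c j 0 * t := by
      rw [Fin.sum_univ_succ]
      simp only [Fin.cons_zero, Fin.cons_succ]
      ring
    have hpair (p q : ι) : -c q 0 * (f p v + ∑ k : Fin m, c p k.succ * x k)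
          + c p 0 * (f q v + ∑ k : Fin m, c q k.succ * x k)
        = (-c q 0 • f p + c p 0 • f q) v
          + ∑ k : Fin m, (-c q 0 * c p k.succ + c p 0 * c q k.succ) * x k := by
      simp only [add_mul, mul_assoc, Finset.sum_add_distrib, ← Finset.mul_sum,
        AffineMap.coe_add, AffineMap.coe_smul, Pi.add_apply, Pi.smul_apply, smul_eq_mul]
      ring
    simp only [hrow, key, hpair, Sum.forall, Sum.elim_inl, Sum.elim_inr, Subtype.forall,
      Prod.forall, pair, and_imp]

theorem mem_downwardClosure_utilityPossibilitySet {n m : ℕ} {X : Set (Fin m → ℝ)}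
    (u : Fin n → X → ℝ) (v : Fin n → ℝ) :
    v ∈ downwardClosure (utilityPossibilitySet u) ↔ ∃ x : X, ∀ i, v i ≤ u i x := by
  simp only [downwardClosure, Set.mem_iUnion, Set.mem_ofPred_eq, exists_prop]
  constructor
  · rintro ⟨w, ⟨x, hx⟩, d, hd, rfl⟩
    exact ⟨x, fun i => (sub_le_self _ (hd i)).trans (hx i).2⟩
  · rintro ⟨x, hx⟩
    exact ⟨fun i => u i x, ⟨x, fun i => ⟨iInf_le _ x, le_rfl⟩⟩, fun i => u i x - v i,
      fun i => sub_nonneg.2 (hx i), funext fun i => (sub_sub_cancel _ _).symm⟩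

theorem proposition1 {n m : ℕ} (X : Set (Fin m → ℝ)) (hX : IsPolyhedron X)
    (u : Fin n → X → ℝ) (hu : ∀ i, IsPLC (u i)) :
    IsPolyhedron (downwardClosure (utilityPossibilitySet u)) := by
  obtain ⟨r, a, b, hX⟩ := hX
  choose N F hF using hu
  -- One row `a j · x - b j ≤ 0` for each inequality of `X`, and one row `v i - F i k x ≤ 0` for
  -- each affine piece of each `u i`.
  convert isPolyhedron_exists (ι := Fin r ⊕ Σ i, Fin (N i + 1))
    (Sum.elim (fun j => AffineMap.const ℝ _ (-b j))
      fun p => (LinearMap.proj (R := ℝ) (φ := fun _ : Fin n => ℝ) p.1).toAffineMap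
        - AffineMap.const ℝ _ (F p.1 p.2 0))
    (Sum.elim a fun p l => -(F p.1 p.2).linear (fun k => if l = k then 1 else 0)) using 1
  ext v
  rw [mem_downwardClosure_utilityPossibilitySet]
  have hmem (x : Fin m → ℝ) : x ∈ X ↔ ∀ j, -b j + ∑ l, a j l * x l ≤ 0 := by
    rw [hX]
    simp only [Set.mem_ofPred_eq, neg_add_nonpos_iff]
  have hpiece (i : Fin n) (k : Fin (N i + 1)) (x : Fin m → ℝ) :
      v i ≤ F i k x ↔ v i - F i k 0
        + ∑ l, -(F i k).linear (fun k => if l = k then 1 else 0) * x l ≤ 0 := by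
    rw [congrFun (F i k).decomp x, Pi.add_apply, LinearMap.pi_apply_eq_sum_univ]
    simp only [smul_eq_mul, neg_mul, Finset.sum_neg_distrib, mul_comm (x _)]
    constructor <;> intro h <;> linarith
  simp only [hF, Finset.le_inf'_iff, Finset.mem_univ, true_imp_iff, Subtype.exists, exists_prop,
    hmem, hpiece, Set.mem_ofPred_eq, Sum.forall, Sigma.forall, Sum.elim_inl, Sum.elim_inr,
    AffineMap.const_apply, AffineMap.coe_sub, Pi.sub_apply, LinearMap.coe_toAffineMap,
    LinearMap.proj_apply]
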